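/- Let $\mathsf{Pos}$ be the category of posets and monotone maps, and let $\mathsf{Pos}_{\mathsf f}$ be a set of finite posets, called contexts (for instance, a set representing all finite posets up to isomorphism). A signature in context $\Sigma$ is a family of sets $(\Sigma_\Gamma)_{\Gamma\in\mathsf{Pos}_{\mathsf f}}$. A $\Sigma$-algebra is a poset $A$ with, for every context $\Gamma$ and every $\sigma\in\Sigma_\Gamma$, a function $\sigma_A$ (not necessarily monotone) from the set of monotone maps $\Gamma\to A$ to $A$. A homomorphism $h\colon A\to B$ is a monotone map with $h(\sigma_A(f))=\sigma_B(h\cdot f)$ for all $\sigma\in\Sigma_\Gamma$ and all monotone $f\colon\Gamma\to A$. This gives the category $\mathsf{Alg}\,\Sigma$. Terms in context $\Gamma$ are the elements of the least set that contains the elements of $\Gamma$ (the variables) and, with every $\sigma\in\Sigma_\Delta$ and every function $g$ from the underlying set of $\Delta$ to terms, contains the term $\sigma(g)$. For a $\Sigma$-algebra $A$, every monotone $f\colon\Gamma\to A$ defines a partial evaluation map $f^\#$ from the terms in context $\Gamma$ to $A$: $f^\#(x)=f(x)$ for variables $x$; and $f^\#(\sigma(g))$ is defined iff all $f^\#(g(i))$,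 $i\in\Delta$, are defined and $i\le j$ in $\Delta$ implies $f^\#(g(i))\le f^\#(g(j))$, in which case $f^\#(\sigma(g))=\sigma_A(f^\#\cdot g)$. An inequation in context $\Gamma\vdash s\le t$ is a pair of terms in context $\Gamma$; an algebra $A$ satisfies it if for every monotone $f\colon\Gamma\to A$ both $f^\#(s)$ and $f^\#(t)$ are defined and $f^\#(s)\le f^\#(t)$. A variety of $\Sigma$-algebras is the full subcategory $\mathcal V$ of $\mathsf{Alg}\,\Sigma$ of all algebras that satisfy every member of a given set $\mathcal E$ of inequations in context. Theorem. For every variety $\mathcal V$ of $\Sigma$-algebras, the forgetful functor $U\colon\mathcal V\to\mathsf{Pos}$ is monadic. In detail: 1. The forgetful functor $\mathsf{Alg}\,\Sigma\to\mathsf{Pos}$ has a left adjoint $F$, the full embedding $\mathcal V\hookrightarrow\mathsf{Alg}\,\Sigma$ has a left adjoint $R$ (so $\mathcal V$ is reflective), and $R\cdot F$ is a left adjoint of $U$. 2. $U$ creates coequalizers of $U$-split pairs. That is, let $f,g\colon A\to B$ be a pair in $\mathcal V$ such that $Uf,Ug$ has a split coequalizer in $\mathsf{Pos}$, and let $c\colon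 UB\to Z$ be any coequalizer of $Uf,Ug$. Then there is exactly one morphism $q\colon B\to Q$ in $\mathcal V$ with $q\cdot f=q\cdot g$, $UQ=Z$ and $Uq=c$, and this $q$ is a coequalizer of $f$ and $g$ in $\mathcal V$. 3. $U$ is monadic: for every left adjoint of $U$, the comparison functor from $\mathcal V$ to the Eilenberg–Moore category of the induced monad on $\mathsf{Pos}$ is an isomorphism of categories (in particular an equivalence). -/

import Mathlib

open CategoryTheory CategoryTheory.Limits

universe u v₁ v₂ u₁ u₂

/-- A set of finite posets, called *contexts* (for instance a set that represents all finite
posets up to isomorphism).  The elements of the poset `C.Var Γ` are the variables of the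
context `Γ`. -/
structure Contexts where
  /-- the set that indexes the contexts -/
  Ctx : Type u
  /-- the set of variables of a context -/
  Var : Ctx → Type u
  /-- the order on the variables of a context -/
  [order : ∀ Γ, PartialOrder (Var Γ)]
  /-- every context has finitely many variables -/
  [finite : ∀ Γ, Finite (Var Γ)]

attribute [instance] Contexts.order Contexts.finite

/-- A signature in context: for every context `Γ` a set of operation symbols of arity `Γ`. -/
structure Signature (C : Contexts.{u}) where
  /-- the set of operation symbols of arity `Γ` -/
  Op : C.Ctx → Type u

namespace Signature

variable {C : Contexts.{u}}

/-- A `Σ`-algebra: a poset `A` with, for every operation symbol `σ` of arity `Γ`, a function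
that assigns an element of `A` to every monotone map from `Γ` to `A`.  (The function need not
be monotone.) -/
structure Alg (S : Signature C) where
  /-- the underlying poset -/
  toPartOrd : PartOrd.{u}
  /-- the operations -/
  op : ∀ {Γ : C.Ctx}, S.Op Γ → (C.Var Γ →o toPartOrd) → toPartOrd

namespace Alg

variable {S : Signature C}

/-- A homomorphism of `Σ`-algebras: a monotone map that commutes with all operations. -/
@[ext]
structure Hom (A B : S.Alg) where
  /-- the underlying monotone map -/
  hom : A.toPartOrd ⟶ B.toPartOrd
  /-- compatibility with the operations -/
  map_op : ∀ {Γ : C.Ctx} (σ : S.Op Γ) (f : C.Var Γ →o A.toPartOrd),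
    hom (A.op σ f) = B.op σ (hom.hom.comp f)

/-- The category of `Σ`-algebras and homomorphisms. -/
instance : Category.{u} S.Alg where
  Hom A B := Hom A B
  id A := ⟨𝟙 A.toPartOrd, fun _ _ => rfl⟩
  comp f g := ⟨f.hom ≫ g.hom, fun σ k => by
    rw [PartOrd.comp_apply, f.map_op, g.map_op]; rfl⟩

end Alg

/-- The forgetful functor from `Σ`-algebras to posets. -/
def forget (S : Signature C) : S.Alg ⥤ PartOrd.{u} where
  obj A := A.toPartOrd
  map f := Alg.Hom.hom f

/-- `S.Term X` is the set of terms with variables from the set `X`.  The order of the arities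
is ignored: an operation symbol of arity `Δ` may be applied to every family of terms that is
indexed by the underlying set of `Δ`. -/
inductive Term (S : Signature C) (X : Type u) : Type u
  | var : X → Term S X
  | app : {Δ : C.Ctx} → S.Op Δ → (C.Var Δ → Term S X) → Term S X

/-- The evaluation of terms in context `Γ` at a monotone interpretation `f` of the variables,
as a partial map: the value of `σ(g)` is defined iff the values of all `g i` are defined and
depend monotonically on `i`. -/
def eval {S : Signature C} (A : S.Alg) {Γ : C.Ctx} (f : C.Var Γ →o A.toPartOrd) :
    S.Term (C.Var Γ) → Part A.toPartOrd
  | .var x => Part.some (f x)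
  | .app σ g =>
    { Dom := ∃ h : ∀ i, (eval A f (g i)).Dom, Monotone fun i => (eval A f (g i)).get (h i)
      get := fun h => A.op σ ⟨fun i => (eval A f (g i)).get (h.fst i), h.snd⟩ }

/-- An inequation in context `Γ ⊢ s ≤ t`. -/
structure Inequation (S : Signature C) where
  /-- the context -/
  ctx : C.Ctx
  /-- the smaller term -/
  lhs : S.Term (C.Var ctx)
  /-- the larger term -/
  rhs : S.Term (C.Var ctx)

/-- An algebra satisfies `Γ ⊢ s ≤ t` if, for every monotone interpretation of the variables,
the values of `s` and `t` are both defined and the first one is below the second one. -/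
def Alg.Satisfies {S : Signature C} (A : S.Alg) (e : S.Inequation) : Prop :=
  ∀ f : C.Var e.ctx →o A.toPartOrd,
    ∃ (hs : (eval A f e.lhs).Dom) (ht : (eval A f e.rhs).Dom),
      (eval A f e.lhs).get hs ≤ (eval A f e.rhs).get ht

/-- The property of being an algebra of the variety presented by the set `E` of inequations. -/
def isModel (S : Signature C) (E : Set S.Inequation) : ObjectProperty S.Alg :=
  fun A => ∀ e ∈ E, A.Satisfies e

/-- The variety presented by `E`: the full subcategory of all algebras that satisfy every
inequation in `E`. -/
abbrev Variety (S : Signature C) (E : Set S.Inequation) : Type (u + 1) :=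
  (S.isModel E).FullSubcategory

/-- The full embedding of a variety into the category of `Σ`-algebras. -/
abbrev varietyInclusion (S : Signature C) (E : Set S.Inequation) : S.Variety E ⥤ S.Alg :=
  (S.isModel E).ι

/-- The forgetful functor from a variety to posets. -/
abbrev varietyForget (S : Signature C) (E : Set S.Inequation) : S.Variety E ⥤ PartOrd.{u} :=
  S.varietyInclusion E ⋙ S.forget

end Signature

/-- `U` (strictly) creates coequalizers of `U`-split pairs: if `f, g : A ⟶ B` is a `U`-split pair
and `c : U B ⟶ Z` is a coequalizer of `U f` and `U g`, then there is exactly one morphism `q`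
with domain `B` that coequalizes `f` and `g` and that `U` sends to `c` (in particular its codomain
to `Z`), and this `q` is a coequalizer of `f` and `g`. -/
def CreatesSplitCoequalizers {𝒟 : Type u₁} [Category.{v₁} 𝒟] {𝒞 : Type u₂} [Category.{v₂} 𝒞]
    (U : 𝒟 ⥤ 𝒞) : Prop :=
  ∀ ⦃A B : 𝒟⦄ (f g : A ⟶ B), U.IsSplitPair f g →
    ∀ (Z : 𝒞) (c : U.obj B ⟶ Z) (w : U.map f ≫ c = U.map g ≫ c),
      Nonempty (IsColimit (Cofork.ofπ c w)) →
        (∃! q : (Q : 𝒟) × (B ⟶ Q), f ≫ q.2 = g ≫ q.2 ∧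
          (⟨U.obj q.1, U.map q.2⟩ : (Y : 𝒞) × (U.obj B ⟶ Y)) = ⟨Z, c⟩) ∧
        ∀ (Q : 𝒟) (q : B ⟶ Q) (h : f ≫ q = g ≫ q),
          (⟨U.obj Q, U.map q⟩ : (Y : 𝒞) × (U.obj B ⟶ Y)) = ⟨Z, c⟩ →
            Nonempty (IsColimit (Cofork.ofπ q h))

/-- A functor is an isomorphism of categories: it has a strict two-sided inverse. -/
def IsCategoryIso {𝒟 : Type u₁} [Category.{v₁} 𝒟] {𝒞 : Type u₂} [Category.{v₂} 𝒞]
    (K : 𝒟 ⥤ 𝒞) : Prop :=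
  ∃ L : 𝒞 ⥤ 𝒟, K ⋙ L = 𝟭 𝒟 ∧ L ⋙ K = 𝟭 𝒞

/-! ### Strict monadicity from creation of split coequalizers -/

section Beck

variable {𝒟 : Type u₁} [Category.{v₁} 𝒟] {𝒞 : Type u₂} [Category.{v₂} 𝒞]

/-! Both left adjoints come from one construction. Given a class `P` of interpretations of a poset
`X` in algebras, take the terms over `X` defined under all of them, compare terms by their values,
and pass to the quotient poset (`generatedAlg`). Terms form a set, so no solution-set argument is
needed. The lifts to the algebras in `P` jointly reflect the order, so definedness and inequations
pass to the quotient. All interpretations give free algebras; homomorphisms into models give the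
reflection.

For a split coequalizer `c` with section `s`, the only possible structure on the quotient is `σ(k) =
c(σ(s ∘ k))`. The splitting makes `c` a homomorphism, and inequations descend by lifting
interpretations along `s`. Strict creation then gives monadicity by Beck's argument. -/

/-- A functor that is fully faithful and bijective on objects is an isomorphism of categories. -/
theorem IsCategoryIso.of_bijective_obj (K : 𝒟 ⥤ 𝒞) [K.Full] [K.Faithful]
    (hK : Function.Bijective K.obj) : IsCategoryIso K := by
  let e := Equiv.ofBijective K.obj hK
  have he : ∀ Y, K.obj (e.symm Y) = Y := e.apply_symm_apply
  let L : 𝒞 ⥤ 𝒟 :=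
    { obj := fun Y => e.symm Y
      map := fun {Y Z} f => K.preimage (eqToHom (he Y) ≫ f ≫ eqToHom (he Z).symm)
      map_id := fun Y => K.map_injective (by simp)
      map_comp := fun f g => K.map_injective (by simp) }
  have map_conj {W X Y Z : 𝒟} (h : W = X) (h' : Y = Z) (f : X ⟶ Y) :
      eqToHom (congrArg K.obj h) ≫ K.map f ≫ eqToHom (congrArg K.obj h') =
        K.map (eqToHom h ≫ f ≫ eqToHom h') := by
    subst h h'
    simp
  refine ⟨L, CategoryTheory.Functor.ext (fun X => e.symm_apply_apply X) fun X Y f => K.map_injective ?_,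
    CategoryTheory.Functor.ext he fun Y Z f => ?_⟩
  · exact (K.map_preimage _).trans (map_conj _ _ f)
  · simp [L]

theorem IsCategoryIso.isEquivalence {K : 𝒟 ⥤ 𝒞} (hK : IsCategoryIso K) : K.IsEquivalence := by
  obtain ⟨L, hKL, hLK⟩ := hK
  exact Functor.IsEquivalence.mk' L (eqToIso hKL.symm) (eqToIso hLK)

/-- A coequalizer of a pair that has a split coequalizer is split. -/
theorem CategoryTheory.HasSplitCoequalizer.nonempty_isSplitCoequalizer {X Y Z : 𝒞} {f g : X ⟶ Y}
    (hfg : HasSplitCoequalizer f g) {c : Y ⟶ Z} {w : f ≫ c = g ≫ c}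
    (hc : IsColimit (Cofork.ofπ c w)) : Nonempty (IsSplitCoequalizer f g c) := by
  obtain ⟨W, p, ⟨h⟩⟩ := hfg.splittable
  obtain ⟨d, hd⟩ := Cofork.IsColimit.desc' hc p h.condition
  replace hd : c ≫ d = p := hd
  refine ⟨⟨d ≫ h.rightSection, h.leftSection, w, Cofork.IsColimit.hom_ext hc ?_,
    h.leftSection_bottom, ?_⟩⟩
  · change c ≫ (d ≫ h.rightSection) ≫ c = c ≫ 𝟙 Z
    rw [Category.assoc, reassoc_of% hd, ← h.leftSection_top_assoc, w, h.leftSection_bottom_assoc,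
      Category.comp_id]
  · rw [h.leftSection_top, reassoc_of% hd]

variable {U : 𝒟 ⥤ 𝒞} {F : 𝒞 ⥤ 𝒟} (adj : F ⊣ U)

/-- If `q : F X ⟶ Q` lies over the structure `a` of an Eilenberg-Moore algebra on `X`, then
that algebra is the image of `Q` under the comparison functor. -/
theorem comparison_obj_eq_of_lift (X : adj.toMonad.Algebra) {Q : 𝒟} (q : F.obj X.A ⟶ Q)
    (hq : (⟨U.obj Q, U.map q⟩ : (Y : 𝒞) × (U.obj (F.obj X.A) ⟶ Y)) = ⟨X.A, X.a⟩) :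
    (Monad.comparison adj).obj Q = X := by
  obtain ⟨A, a, hu, ha⟩ := X
  dsimp at q hq hu
  obtain ⟨rfl, h⟩ := Sigma.mk.inj hq
  obtain rfl := eq_of_heq h
  -- The transpose of `q` is the identity, by the unit law of the algebra.
  have hq' : q = adj.counit.app Q := by
    apply (adj.homEquiv _ _).injective
    have hu' : adj.unit.app (U.obj Q) ≫ U.map q = 𝟙 (U.obj Q) := hu
    rw [Adjunction.homEquiv_unit, Adjunction.homEquiv_unit, hu']
    exact (adj.right_triangle_components Q).symm
  subst hq'
  rfl

/-- An algebra structure `a` is a split coequalizer of `U(F a)` and `U(ε)`. Existence of its lift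
gives surjectivity on objects, uniqueness gives injectivity, and the coequalizer property of the
counits gives full faithfulness. -/
theorem CreatesSplitCoequalizers.isCategoryIso_comparison (hU : CreatesSplitCoequalizers U) :
    IsCategoryIso (Monad.comparison adj) := by
  have hsplit (X : adj.toMonad.Algebra) :=
    hU (F.map X.a) (adj.counit.app (F.obj X.A)) ⟨_, _, ⟨Monad.beckSplitCoequalizer X⟩⟩ X.A X.a
      (Monad.beckSplitCoequalizer X).condition ⟨(Monad.beckSplitCoequalizer X).isCoequalizer⟩
  have hcounit (Q : 𝒟) : F.map (U.map (adj.counit.app Q)) ≫ adj.counit.app Q =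
      adj.counit.app (F.obj (U.obj Q)) ≫ adj.counit.app Q := adj.counit_naturality _
  have hcolim (Q : 𝒟) : Nonempty (IsColimit (Cofork.ofπ _ (hcounit Q))) :=
    (hsplit ((Monad.comparison adj).obj Q)).2 Q (adj.counit.app Q) (hcounit Q) rfl
  have hepi (Q : 𝒟) : Epi (adj.counit.app Q) := (hcolim Q).elim fun h => Cofork.IsColimit.epi h
  have : (Monad.comparison adj).Faithful := ⟨fun {P Q f g} hfg => by
    have h : U.map f = U.map g := congrArg Monad.Algebra.Hom.f hfg
    exact (cancel_epi (adj.counit.app P)).1 ((adj.counit_naturality f).symm.trans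
      ((congrArg (fun k => F.map k ≫ adj.counit.app Q) h).trans (adj.counit_naturality g)))⟩
  have : (Monad.comparison adj).Full := ⟨fun {P Q} h => by
    obtain ⟨hP⟩ := hcolim P
    obtain ⟨k, hk⟩ : ∃ k : U.obj P ⟶ U.obj Q, k = h.f := ⟨_, rfl⟩
    have hh : U.map (F.map k) ≫ U.map (adj.counit.app Q) = U.map (adj.counit.app P) ≫ k :=
      hk ▸ h.h
    obtain ⟨m, hm⟩ := Cofork.IsColimit.desc' hP (F.map k ≫ adj.counit.app Q) (by
      have h₁ : F.map (U.map (adj.counit.app P)) ≫ F.map k =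
          F.map (U.map (F.map k)) ≫ F.map (U.map (adj.counit.app Q)) := by
        rw [← F.map_comp, ← F.map_comp, hh]
      have h₂ : F.map (U.map (F.map k)) ≫ adj.counit.app (F.obj (U.obj Q)) =
          adj.counit.app (F.obj (U.obj P)) ≫ F.map k := adj.counit_naturality _
      rw [reassoc_of% h₁, hcounit Q, reassoc_of% h₂])
    replace hm : adj.counit.app P ≫ m = F.map k ≫ adj.counit.app Q := hm
    refine ⟨m, Monad.Algebra.Hom.ext ?_⟩
    have h₃ : U.map (adj.counit.app P) ≫ U.map m = U.map (adj.counit.app P) ≫ k := by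
      rw [← hh, ← U.map_comp, ← U.map_comp, hm]
    have h₄ := adj.right_triangle_components P
    have h₅ := congrArg (fun l => adj.unit.app (U.obj P) ≫ l) h₃
    rw [reassoc_of% h₄, reassoc_of% h₄] at h₅
    exact h₅.trans hk⟩
  refine IsCategoryIso.of_bijective_obj _ ⟨fun P Q hPQ => ?_, fun X => ?_⟩
  · obtain ⟨_, -, huniq⟩ := (hsplit ((Monad.comparison adj).obj P)).1
    have hlift (P Q : 𝒟) (h : (Monad.comparison adj).obj P = (Monad.comparison adj).obj Q) :
        ∃ q : F.obj (U.obj P) ⟶ Q, F.map (U.map (adj.counit.app P)) ≫ q =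
            adj.counit.app (F.obj (U.obj P)) ≫ q ∧
          (⟨U.obj Q, U.map q⟩ : (Y : 𝒞) × (U.obj (F.obj (U.obj P)) ⟶ Y)) =
            ⟨U.obj P, U.map (adj.counit.app P)⟩ := by
      -- Generalizing over the algebra lets its equality be eliminated without transporting
      -- morphisms.
      have key : ∀ X : adj.toMonad.Algebra, X = (Monad.comparison adj).obj Q →
          ∃ q : F.obj X.A ⟶ Q, F.map X.a ≫ q = adj.counit.app (F.obj X.A) ≫ q ∧
            (⟨U.obj Q, U.map q⟩ : (Y : 𝒞) × (U.obj (F.obj X.A) ⟶ Y)) = ⟨X.A, X.a⟩ := by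
        rintro _ rfl
        exact ⟨adj.counit.app Q, hcounit Q, rfl⟩
      exact key _ h
    obtain ⟨q, hq⟩ := hlift P Q hPQ
    exact congrArg Sigma.fst
      ((huniq ⟨P, adj.counit.app P⟩ ⟨hcounit P, rfl⟩).trans (huniq ⟨Q, q⟩ hq).symm)
  · obtain ⟨⟨Q, q⟩, ⟨-, hq⟩, -⟩ := (hsplit X).1
    exact ⟨Q, comparison_obj_eq_of_lift adj X q hq⟩

end Beck

/-! ### Values of terms and joint reflection of the order -/

namespace Signature

variable {C : Contexts.{u}} {S : Signature C}

/-- `A.Evaluates f t a` says that the term `t` has the value `a` in the algebra `A` if its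
variables are interpreted by `f`. -/
inductive Alg.Evaluates (A : S.Alg) {X : Type u} (f : X → A.toPartOrd) :
    S.Term X → A.toPartOrd → Prop
  | var (x : X) : Evaluates A f (.var x) (f x)
  | app {Δ : C.Ctx} (σ : S.Op Δ) (g : C.Var Δ → S.Term X) (k : C.Var Δ →o A.toPartOrd)
      (h : ∀ i, Evaluates A f (g i) (k i)) : Evaluates A f (.app σ g) (A.op σ k)

namespace Alg.Evaluates

variable {A B : S.Alg} {X : Type u} {f : X → A.toPartOrd}

theorem var_iff {x : X} {a : A.toPartOrd} : A.Evaluates f (.var x) a ↔ a = f x :=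
  ⟨fun h => by cases h; rfl, fun h => h ▸ .var x⟩

theorem app_iff {Δ : C.Ctx} {σ : S.Op Δ} {g : C.Var Δ → S.Term X} {a : A.toPartOrd} :
    A.Evaluates f (.app σ g) a ↔
      ∃ k : C.Var Δ →o A.toPartOrd, (∀ i, A.Evaluates f (g i) (k i)) ∧ A.op σ k = a :=
  ⟨fun h => by cases h with | app _ _ k h => exact ⟨k, h, rfl⟩,
    fun ⟨k, h, e⟩ => e ▸ .app σ g k h⟩

theorem unique {t : S.Term X} {a b : A.toPartOrd} (ha : A.Evaluates f t a)
    (hb : A.Evaluates f t b) : a = b := by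
  induction ha generalizing b with
  | var x => exact (var_iff.1 hb).symm
  | app σ g k _ ih =>
    obtain ⟨l, hl, rfl⟩ := app_iff.1 hb
    exact congrArg _ (OrderHom.ext _ _ (funext fun i => ih i (hl i)))

/-- Definedness is preserved because a homomorphism keeps monotone families of arguments monotone.
-/
theorem map (φ : A ⟶ B) {t : S.Term X} {a : A.toPartOrd} (h : A.Evaluates f t a) :
    B.Evaluates (φ.hom ∘ f) t (φ.hom a) := by
  induction h with
  | var x => exact .var x
  | app σ g k _ ih =>
    rw [φ.map_op]
    exact .app σ g _ ih

end Alg.Evaluates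

/-- The relation is the graph of `eval`; unlike `eval` it allows an arbitrary set of variables and
carries no domain proofs. -/
theorem mem_eval_iff {A : S.Alg} {Γ : C.Ctx} (f : C.Var Γ →o A.toPartOrd)
    (t : S.Term (C.Var Γ)) (a : A.toPartOrd) : a ∈ eval A f t ↔ A.Evaluates f t a := by
  induction t generalizing a with
  | var x => rw [eval, Part.mem_some_iff, Alg.Evaluates.var_iff]
  | app σ g ih =>
    rw [eval, Alg.Evaluates.app_iff]
    constructor
    · rintro ⟨⟨h, hm⟩, rfl⟩
      exact ⟨⟨_, hm⟩, fun i => (ih i _).1 (Part.get_mem (h i)), rfl⟩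
    · rintro ⟨k, hk, rfl⟩
      have h : ∀ i, (eval A f (g i)).Dom := fun i => ((ih i _).2 (hk i)).1
      have hk' : (fun i => (eval A f (g i)).get (h i)) = k :=
        funext fun i => Part.get_eq_of_mem ((ih i _).2 (hk i)) (h i)
      exact ⟨⟨h, by rw [hk']; exact k.monotone⟩, congrArg _ (OrderHom.ext _ _ hk')⟩

theorem satisfies_iff {A : S.Alg} {e : S.Inequation} :
    A.Satisfies e ↔ ∀ f : C.Var e.ctx →o A.toPartOrd,
      ∃ a b, A.Evaluates f e.lhs a ∧ A.Evaluates f e.rhs b ∧ a ≤ b := by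
  refine forall_congr' fun f => ⟨?_, ?_⟩
  · rintro ⟨hs, ht, h⟩
    exact ⟨_, _, (mem_eval_iff _ _ _).1 (Part.get_mem hs), (mem_eval_iff _ _ _).1 (Part.get_mem ht),
      h⟩
  · rintro ⟨a, b, ha, hb, h⟩
    obtain ⟨hs, rfl⟩ := (mem_eval_iff _ _ _).2 ha
    obtain ⟨ht, rfl⟩ := (mem_eval_iff _ _ _).2 hb
    exact ⟨hs, ht, h⟩

/-- If the homomorphisms out of `B` that have a property `P` jointly reflect the order, then a
term has a value in `B` as soon as it has a value in all of their codomains. -/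
theorem Alg.exists_evaluates_of_jointly_reflecting {B : S.Alg} {P : ∀ A : S.Alg, (B ⟶ A) → Prop}
    (hP : ∀ x y : B.toPartOrd, (∀ A φ, P A φ → φ.hom x ≤ φ.hom y) → x ≤ y)
    {X : Type u} (p : X → B.toPartOrd) (t : S.Term X)
    (ht : ∀ A (φ : B ⟶ A), P A φ → ∃ a, A.Evaluates (φ.hom ∘ p) t a) :
    ∃ b, B.Evaluates p t b := by
  induction t with
  | var x => exact ⟨_, .var x⟩
  | app σ g ih =>
    have ht' : ∀ i, ∃ b, B.Evaluates p (g i) b := fun i => ih i fun A φ hφ => by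
      obtain ⟨_, h⟩ := ht A φ hφ
      obtain ⟨k, hk, -⟩ := Evaluates.app_iff.1 h
      exact ⟨_, hk i⟩
    choose b hb using ht'
    -- The only obstruction to definedness is monotonicity of `b`, which is tested in the codomains.
    refine ⟨_, .app σ g ⟨b, fun i j hij => hP _ _ fun A φ hφ => ?_⟩ hb⟩
    obtain ⟨_, h⟩ := ht A φ hφ
    obtain ⟨k, hk, -⟩ := Evaluates.app_iff.1 h
    rw [((hb i).map φ).unique (hk i), ((hb j).map φ).unique (hk j)]
    exact k.monotone hij

theorem isModel_of_jointly_reflecting {E : Set S.Inequation} {B : S.Alg}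
    {P : ∀ A : S.Alg, (B ⟶ A) → Prop} (hPE : ∀ A φ, P A φ → S.isModel E A)
    (hP : ∀ x y : B.toPartOrd, (∀ A φ, P A φ → φ.hom x ≤ φ.hom y) → x ≤ y) :
    S.isModel E B := by
  refine fun e he => satisfies_iff.2 fun p => ?_
  have h (A : S.Alg) (φ : B ⟶ A) (hφ : P A φ) :=
    satisfies_iff.1 (hPE A φ hφ e he) (φ.hom.hom.comp p)
  obtain ⟨a, ha⟩ := Alg.exists_evaluates_of_jointly_reflecting hP p e.lhs fun A φ hφ =>
    let ⟨a, _, ha, _⟩ := h A φ hφ; ⟨a, ha⟩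
  obtain ⟨b, hb⟩ := Alg.exists_evaluates_of_jointly_reflecting hP p e.rhs fun A φ hφ =>
    let ⟨_, b, _, hb, _⟩ := h A φ hφ; ⟨b, hb⟩
  refine ⟨a, b, ha, hb, hP _ _ fun A φ hφ => ?_⟩
  obtain ⟨a', b', ha', hb', hab⟩ := h A φ hφ
  rwa [(ha.map φ).unique ha', (hb.map φ).unique hb']

end Signature

/-! ### The algebra generated by a class of interpretations -/

namespace Signature

variable {C : Contexts.{u}} {S : Signature C}

section Generated

variable {X : PartOrd.{u}} (P : ∀ A : S.Alg, (X ⟶ A.toPartOrd) → Prop)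

/-- The terms over `X` that have a value under every interpretation with the property `P`. -/
def DefinedTerm : Type u :=
  {t : S.Term X // ∀ A f, P A f → ∃ a, A.Evaluates f t a}

/-- A term is below another one if this holds for their values under all interpretations with the
property `P`. -/
instance : Preorder (DefinedTerm P) where
  le s t := ∀ A f, P A f → ∀ a b, A.Evaluates f s.1 a → A.Evaluates f t.1 b → a ≤ b
  le_refl _ _ _ _ _ _ ha hb := (ha.unique hb).le
  le_trans _ t _ hst htr A f h a c ha hc :=
    let ⟨b, hb⟩ := t.2 A f h
    (hst A f h a b ha hb).trans (htr A f h b c hb hc)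

/-- The value of a term under an interpretation with the property `P`. -/
noncomputable def DefinedTerm.value {A : S.Alg} {f : X ⟶ A.toPartOrd} (h : P A f) :
    DefinedTerm P →o A.toPartOrd where
  toFun t := (t.2 A f h).choose
  monotone' s t hst := hst A f h _ _ (s.2 A f h).choose_spec (t.2 A f h).choose_spec

variable {P} in
theorem DefinedTerm.evaluates_value {A : S.Alg} {f : X ⟶ A.toPartOrd} (h : P A f)
    (t : DefinedTerm P) : A.Evaluates f t.1 (value P h t) :=
  (t.2 A f h).choose_spec

variable {P} in
theorem DefinedTerm.value_ofAntisymmetrization_toAntisymmetrization {A : S.Alg}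
    {f : X ⟶ A.toPartOrd} (h : P A f) (t : DefinedTerm P) :
    value P h (ofAntisymmetrization (· ≤ ·) (toAntisymmetrization (· ≤ ·) t)) = value P h t := by
  have ht : AntisymmRel (· ≤ ·) (ofAntisymmetrization (· ≤ ·) (toAntisymmetrization (· ≤ ·) t)) t :=
    Quotient.exact (toAntisymmetrization_ofAntisymmetrization _ _)
  exact le_antisymm ((value P h).monotone ht.1) ((value P h).monotone ht.2)

/-- The application of an operation symbol to a monotone family of defined terms. -/
noncomputable def DefinedTerm.app {Δ : C.Ctx} (σ : S.Op Δ) (g : C.Var Δ →o DefinedTerm P) :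
    DefinedTerm P :=
  ⟨.app σ fun i => (g i).1, fun _ _ h =>
    ⟨_, .app σ _ ((value P h).comp g) fun i => evaluates_value h (g i)⟩⟩

/-- The algebra generated by the poset `X` in the product of all algebras `A` with an
interpretation `f : X ⟶ A` that has the property `P`. -/
noncomputable def generatedAlg : S.Alg where
  toPartOrd := .of (Antisymmetrization (DefinedTerm P) (· ≤ ·))
  op σ k := toAntisymmetrization _ (DefinedTerm.app P σ
    ((OrderEmbedding.ofAntisymmetrization (DefinedTerm P)).toOrderHom.comp k))

/-- The universal interpretation in the generated algebra. -/
noncomputable def generatedUnit : X ⟶ (generatedAlg P).toPartOrd :=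
  PartOrd.ofHom ⟨fun x => toAntisymmetrization _ ⟨.var x, fun _ _ _ => ⟨_, .var x⟩⟩,
    fun x y hxy => by
      rintro A f - a b ha hb
      rw [Alg.Evaluates.var_iff.1 ha, Alg.Evaluates.var_iff.1 hb]
      exact f.hom.monotone hxy⟩

variable {P}

/-- The homomorphic extension of an interpretation with the property `P`. -/
noncomputable def generatedLift {A : S.Alg} {f : X ⟶ A.toPartOrd} (h : P A f) :
    generatedAlg P ⟶ A where
  hom := PartOrd.ofHom ⟨fun x => DefinedTerm.value P h (ofAntisymmetrization _ x),
    fun _ _ hxy => (DefinedTerm.value P h).monotone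
      ((OrderEmbedding.ofAntisymmetrization (DefinedTerm P)).monotone hxy)⟩
  map_op σ k :=
    (DefinedTerm.value_ofAntisymmetrization_toAntisymmetrization h _).trans
      ((DefinedTerm.evaluates_value h _).unique (.app σ _
        ((DefinedTerm.value P h).comp
          ((OrderEmbedding.ofAntisymmetrization (DefinedTerm P)).toOrderHom.comp k))
        fun _ => DefinedTerm.evaluates_value h _))

theorem generatedUnit_comp_lift {A : S.Alg} {f : X ⟶ A.toPartOrd} (h : P A f) :
    generatedUnit P ≫ (generatedLift h).hom = f := by
  ext x
  refine (DefinedTerm.value_ofAntisymmetrization_toAntisymmetrization h _).trans ?_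
  exact Alg.Evaluates.var_iff.1
    (DefinedTerm.evaluates_value h ⟨.var x, fun _ _ _ => ⟨_, .var x⟩⟩)

theorem generatedLift_jointly_reflecting (x y : (generatedAlg P).toPartOrd)
    (h : ∀ (A : S.Alg) (f : X ⟶ A.toPartOrd) (hf : P A f),
      (generatedLift hf).hom x ≤ (generatedLift hf).hom y) : x ≤ y := by
  refine (OrderEmbedding.ofAntisymmetrization (DefinedTerm P)).le_iff_le.1 fun A f hf a b ha hb => ?_
  rw [ha.unique (DefinedTerm.evaluates_value hf _), hb.unique (DefinedTerm.evaluates_value hf _)]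
  exact h A f hf

/-- Shows that `X` generates the algebra: each element is the value of a term. Joint reflection
yields some value, and every lift identifies it with the class of `t`. -/
theorem evaluates_generatedAlg (t : DefinedTerm P) :
    (generatedAlg P).Evaluates (generatedUnit P) t.1 (toAntisymmetrization (· ≤ ·) t) := by
  obtain ⟨b, hb⟩ := Alg.exists_evaluates_of_jointly_reflecting
    (P := fun A φ => P A (generatedUnit P ≫ φ.hom))
    (fun x y h => generatedLift_jointly_reflecting x y fun A f hf =>
      h A _ (by rwa [generatedUnit_comp_lift]))
    (generatedUnit P) t.1 fun A φ h => t.2 A _ h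
  have h (A : S.Alg) (f : X ⟶ A.toPartOrd) (hf : P A f) :
      (generatedLift hf).hom b = (generatedLift hf).hom (toAntisymmetrization (· ≤ ·) t) := by
    have hb' : A.Evaluates (generatedUnit P ≫ (generatedLift hf).hom) t.1
      ((generatedLift hf).hom b) := hb.map (generatedLift hf)
    rw [generatedUnit_comp_lift] at hb'
    exact (hb'.unique (DefinedTerm.evaluates_value hf t)).trans
      (DefinedTerm.value_ofAntisymmetrization_toAntisymmetrization hf t).symm
  have hbt : b = toAntisymmetrization (· ≤ ·) t :=
    le_antisymm (generatedLift_jointly_reflecting _ _ fun A f hf => (h A f hf).le)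
      (generatedLift_jointly_reflecting _ _ fun A f hf => (h A f hf).ge)
  rwa [← hbt]

theorem generatedAlg_hom_ext {A : S.Alg} {φ ψ : generatedAlg P ⟶ A}
    (h : generatedUnit P ≫ φ.hom = generatedUnit P ≫ ψ.hom) : φ = ψ := by
  refine Alg.Hom.ext (PartOrd.ext fun x => ?_)
  induction x using Antisymmetrization.ind with | _ t
  have hφ : A.Evaluates (generatedUnit P ≫ φ.hom) t.1 (φ.hom (toAntisymmetrization (· ≤ ·) t)) :=
    (evaluates_generatedAlg t).map φ
  have hψ : A.Evaluates (generatedUnit P ≫ ψ.hom) t.1 (ψ.hom (toAntisymmetrization (· ≤ ·) t)) :=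
    (evaluates_generatedAlg t).map ψ
  rw [h] at hφ
  exact hφ.unique hψ

theorem generatedAlg_isModel {E : Set S.Inequation} (hP : ∀ A f, P A f → S.isModel E A) :
    S.isModel E (generatedAlg P) :=
  isModel_of_jointly_reflecting
    (P := fun A φ => P A (generatedUnit P ≫ φ.hom))
    (fun A φ h => hP _ _ h) fun x y h =>
      generatedLift_jointly_reflecting x y fun A f hf => h A _ (by rwa [generatedUnit_comp_lift])

end Generated
end Signature

/-! ### Free algebras and the reflection -/

namespace Signature

variable {C : Contexts.{u}} {S : Signature C}

section Adjoints

theorem forget_isRightAdjoint : S.forget.IsRightAdjoint := by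
  let e (X : PartOrd.{u}) (A : S.Alg) :
      (generatedAlg (X := X) (fun (_ : S.Alg) _ => True) ⟶ A) ≃ (X ⟶ S.forget.obj A) :=
    { toFun := fun φ => generatedUnit _ ≫ φ.hom
      invFun := fun f => generatedLift (f := f) trivial
      left_inv := fun _ => generatedAlg_hom_ext (generatedUnit_comp_lift _)
      right_inv := fun _ => generatedUnit_comp_lift _ }
  exact (Adjunction.adjunctionOfEquivLeft e fun _ _ _ _ _ => rfl).isRightAdjoint

theorem varietyInclusion_isRightAdjoint (E : Set S.Inequation) :
    (S.varietyInclusion E).IsRightAdjoint := by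
  let P (B A : S.Alg) (f : B.toPartOrd ⟶ A.toPartOrd) : Prop :=
    S.isModel E A ∧ ∃ φ : B ⟶ A, φ.hom = f
  let unit (B : S.Alg) : B ⟶ generatedAlg (P B) :=
    { hom := generatedUnit (P B)
      map_op := fun {Γ} σ k => by
        -- Compatibility with operations is checked after each lift, where the unit becomes a
        -- homomorphism `φ`.
        have h (A : S.Alg) (f : B.toPartOrd ⟶ A.toPartOrd) (hf : P B A f) :
            (generatedLift hf).hom (generatedUnit (P B) (B.op σ k)) =
              (generatedLift hf).hom
                ((generatedAlg (P B)).op σ ((generatedUnit (P B)).hom.comp k)) := by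
          have hu := generatedUnit_comp_lift hf
          obtain ⟨-, φ, rfl⟩ := id hf
          rw [(generatedLift hf).map_op, ← PartOrd.comp_apply, hu, φ.map_op]
          exact congrArg (fun l => A.op σ (PartOrd.Hom.hom l |>.comp k)) hu.symm
        exact le_antisymm (generatedLift_jointly_reflecting _ _ fun A f hf => (h A f hf).le)
          (generatedLift_jointly_reflecting _ _ fun A f hf => (h A f hf).ge) }
  let e (B : S.Alg) (A : S.Variety E) :
      ((⟨generatedAlg (P B), generatedAlg_isModel fun _ _ h => h.1⟩ : S.Variety E) ⟶ A) ≃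
        (B ⟶ (S.varietyInclusion E).obj A) :=
    { toFun := fun φ => unit B ≫ φ.hom
      invFun := fun ψ => ObjectProperty.homMk (generatedLift (f := ψ.hom) ⟨A.2, ψ, rfl⟩)
      left_inv := fun φ => ObjectProperty.hom_ext _
        (generatedAlg_hom_ext (generatedUnit_comp_lift _))
      right_inv := fun ψ => Alg.Hom.ext (generatedUnit_comp_lift _) }
  exact (Adjunction.adjunctionOfEquivLeft e fun _ _ _ _ _ => rfl).isRightAdjoint

end Adjoints

/-! ### Creation of split coequalizers -/

section SplitCoequalizers

variable {A B : S.Alg} {Z : PartOrd.{u}} {c : B.toPartOrd ⟶ Z}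

/-- The algebra structure on a retract `c : B ⟶ Z`, `s : Z ⟶ B` of the poset of an algebra `B`. -/
def Alg.retract (B : S.Alg) (c : B.toPartOrd ⟶ Z) (s : Z ⟶ B.toPartOrd) : S.Alg where
  toPartOrd := Z
  op σ k := c (B.op σ (s.hom.comp k))

/-- The coequalizing map of a split coequalizer of homomorphisms is a homomorphism. -/
def Alg.toRetract {f g : A ⟶ B} (h : IsSplitCoequalizer f.hom g.hom c) :
    B ⟶ B.retract c h.rightSection where
  hom := c
  map_op {Γ} σ k := by
    -- With `t` the left section, `k = g ∘ t ∘ k` and `f ∘ t ∘ k = s ∘ c ∘ k`; since `c` equalizes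
    -- `f` and `g` on `σ(t ∘ k)`, the claim follows.
    have hg : k = g.hom.hom.comp (h.leftSection.hom.comp k) := OrderHom.ext _ _ <| funext fun i =>
      (ConcreteCategory.congr_hom h.leftSection_bottom (k i)).symm
    have hf : f.hom.hom.comp (h.leftSection.hom.comp k) = h.rightSection.hom.comp (c.hom.comp k) :=
      OrderHom.ext _ _ <| funext fun i => ConcreteCategory.congr_hom h.leftSection_top (k i)
    have hfg := ConcreteCategory.congr_hom h.condition (A.op σ (h.leftSection.hom.comp k))
    calc c (B.op σ k) = c (g.hom (A.op σ (h.leftSection.hom.comp k))) := by rw [g.map_op, ← hg]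
      _ = c (f.hom (A.op σ (h.leftSection.hom.comp k))) := hfg.symm
      _ = c (B.op σ (h.rightSection.hom.comp (c.hom.comp k))) := by rw [f.map_op, hf]

/-- An interpretation `p` in `Q` lifts to `s ∘ p`, and `q` carries the values in `B` and their
inequality back to `Q`. -/
theorem isModel_of_hom_of_section {E : Set S.Inequation} (hB : S.isModel E B) {Q : S.Alg}
    (q : B ⟶ Q) (s : Q.toPartOrd ⟶ B.toPartOrd) (hs : s ≫ q.hom = 𝟙 Q.toPartOrd) :
    S.isModel E Q := by
  refine fun e he => satisfies_iff.2 fun p => ?_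
  obtain ⟨a, b, ha, hb, hab⟩ := satisfies_iff.1 (hB e he) (s.hom.comp p)
  have hp : q.hom ∘ s.hom.comp p = p := funext fun i => ConcreteCategory.congr_hom hs (p i)
  exact ⟨_, _, hp ▸ ha.map q, hp ▸ hb.map q, q.hom.hom.monotone hab⟩

/-- A monotone map is a homomorphism if its composite with a homomorphism `q` is one and `q` has a
monotone section. -/
def Alg.homOfCompEq {Q W : S.Alg} (q : B ⟶ Q) (s : Q.toPartOrd ⟶ B.toPartOrd)
    (hs : s ≫ q.hom = 𝟙 Q.toPartOrd) (φ : B ⟶ W) (m : Q.toPartOrd ⟶ W.toPartOrd)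
    (hm : q.hom ≫ m = φ.hom) : Q ⟶ W where
  hom := m
  map_op σ k := by
    have hk : k = q.hom.hom.comp (s.hom.comp k) := OrderHom.ext _ _ <| funext fun i =>
      (ConcreteCategory.congr_hom hs (k i)).symm
    rw [hk, ← q.map_op, ← PartOrd.comp_apply, hm, φ.map_op, ← hm]
    rfl

/-- Every `k` factors as `q₁ ∘ (s ∘ k)`, so its value is forced to be the image of `σ(s ∘ k)`. -/
theorem Alg.eq_of_hom_of_section {op₁ op₂ : ∀ {Γ : C.Ctx}, S.Op Γ → (C.Var Γ →o Z) → Z}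
    (q₁ : B ⟶ ⟨Z, op₁⟩) (q₂ : B ⟶ ⟨Z, op₂⟩) (h : q₁.hom = q₂.hom) (s : Z ⟶ B.toPartOrd)
    (hs : s ≫ q₁.hom = 𝟙 Z) : @op₁ = @op₂ := by
  funext Γ σ k
  have hk : k = q₁.hom.hom.comp (s.hom.comp k) := OrderHom.ext _ _ <| funext fun i =>
    (ConcreteCategory.congr_hom hs (k i)).symm
  have h₁ := q₁.map_op σ (s.hom.comp k)
  have h₂ := q₂.map_op σ (s.hom.comp k)
  rw [h] at h₁ hk
  exact (congrArg (op₁ σ) hk).trans (h₁.symm.trans (h₂.trans (congrArg (op₂ σ) hk.symm)))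

/-- A morphism of a variety whose underlying map is a split epimorphism is determined, together
with its codomain, by its underlying map. -/
theorem variety_lift_unique {E : Set S.Inequation} {B Q₁ Q₂ : S.Variety E} (q₁ : B ⟶ Q₁)
    (q₂ : B ⟶ Q₂) (s : Q₂.obj.toPartOrd ⟶ B.obj.toPartOrd) (hs : s ≫ q₂.hom.hom = 𝟙 _)
    (h : (⟨Q₁.obj.toPartOrd, q₁.hom.hom⟩ : (Y : PartOrd.{u}) × (B.obj.toPartOrd ⟶ Y)) =
      ⟨Q₂.obj.toPartOrd, q₂.hom.hom⟩) :
    (⟨Q₁, q₁⟩ : (Q : S.Variety E) × (B ⟶ Q)) = ⟨Q₂, q₂⟩ := by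
  obtain ⟨⟨Y₁, op₁⟩, hQ₁⟩ := Q₁
  obtain ⟨⟨Y₂, op₂⟩, hQ₂⟩ := Q₂
  obtain ⟨q₁⟩ := q₁
  obtain ⟨q₂⟩ := q₂
  obtain ⟨h₀, h₁⟩ := Sigma.mk.inj h
  dsimp only at h₀
  subst h₀
  replace h₁ : q₁.hom = q₂.hom := eq_of_heq h₁
  obtain rfl : @op₂ = @op₁ := Alg.eq_of_hom_of_section q₂ q₁ h₁.symm s hs
  obtain rfl : q₁ = q₂ := Alg.Hom.ext h₁
  rfl

theorem varietyForget_createsSplitCoequalizers (E : Set S.Inequation) :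
    CreatesSplitCoequalizers (S.varietyForget E) := by
  intro A B f g hfg Z c w ⟨hc⟩
  obtain ⟨h⟩ := HasSplitCoequalizer.nonempty_isSplitCoequalizer hfg hc
  have h' : IsSplitCoequalizer f.hom.hom g.hom.hom c := h
  refine ⟨?_, ?_⟩
  · let q := Alg.toRetract h'
    let Q : S.Variety E :=
      ⟨B.obj.retract c h'.rightSection,
        isModel_of_hom_of_section B.2 q h'.rightSection h'.rightSection_π⟩
    refine ⟨⟨Q, ObjectProperty.homMk q⟩, ⟨ObjectProperty.hom_ext _ (Alg.Hom.ext w), rfl⟩, ?_⟩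
    rintro ⟨Q', r⟩ ⟨-, hr⟩
    exact variety_lift_unique (Q₂ := Q) r (ObjectProperty.homMk q) h'.rightSection h'.rightSection_π hr
  · intro Q q hq e
    obtain ⟨Q, hQ⟩ := Q
    obtain ⟨rfl, hqc⟩ := Sigma.mk.inj e
    obtain rfl := eq_of_heq hqc
    refine ⟨Cofork.IsColimit.mk' _ fun s => ?_⟩
    have hs : f.hom.hom ≫ s.π.hom.hom = g.hom.hom ≫ s.π.hom.hom :=
      congrArg (fun φ => (S.varietyForget E).map φ) s.condition
    obtain ⟨m, hm⟩ := Cofork.IsColimit.desc' hc s.π.hom.hom hs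
    let ψ := Alg.homOfCompEq q.hom h'.rightSection h'.rightSection_π s.π.hom m hm
    refine ⟨ObjectProperty.homMk ψ, ObjectProperty.hom_ext _ (Alg.Hom.ext hm), fun {m} hm' => ?_⟩
    refine ObjectProperty.hom_ext _ (Alg.Hom.ext (Cofork.IsColimit.hom_ext hc ?_))
    refine Eq.trans ?_ hm.symm
    exact congrArg (fun φ => (S.varietyForget E).map φ) hm'

end SplitCoequalizers

end Signature

theorem theoremT (C : Contexts.{u}) (S : Signature C) (E : Set S.Inequation) :
    -- the left adjoint: free `Σ`-algebras followed by the reflection into the variety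
    (∃ (F : PartOrd.{u} ⥤ S.Alg) (R : S.Alg ⥤ S.Variety E),
      Nonempty (F ⊣ S.forget) ∧ Nonempty (R ⊣ S.varietyInclusion E) ∧
        Nonempty (F ⋙ R ⊣ S.varietyForget E)) ∧
    -- coequalizers of `U`-split pairs are created
    CreatesSplitCoequalizers (S.varietyForget E) ∧
    -- monadicity, up to equivalence and up to isomorphism of categories
    Nonempty (MonadicRightAdjoint (S.varietyForget E)) ∧
    ∀ (F : PartOrd.{u} ⥤ S.Variety E) (adj : F ⊣ S.varietyForget E),
      IsCategoryIso (Monad.comparison adj) := by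
  obtain ⟨F, ⟨adjF⟩⟩ := S.forget_isRightAdjoint
  obtain ⟨R, ⟨adjR⟩⟩ := S.varietyInclusion_isRightAdjoint E
  have hU := S.varietyForget_createsSplitCoequalizers E
  exact ⟨⟨F, R, ⟨adjF⟩, ⟨adjR⟩, ⟨adjF.comp adjR⟩⟩, hU,
    ⟨⟨F ⋙ R, adjF.comp adjR, (hU.isCategoryIso_comparison _).isEquivalence⟩⟩,
    fun _ adj => hU.isCategoryIso_comparison adj⟩
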